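/- Let $K$ be a field of characteristic zero and $A$ an associative unital $K$-algebra; $\otimes$ means $\otimes_K$. Let $\Omega^1(A)=\ker(\mu\colon A\otimes A\to A)$ be the $A$-bimodule of noncommutative Kähler differentials, where $\mu$ is the multiplication and the bimodule structure is $a.(a'\otimes a'').b=aa'\otimes a''b$, with the universal derivation $d\colon A\to\Omega^1(A)$, $da=1\otimes a-a\otimes 1$. Let $\Omega^\bullet(A)=T_A(\Omega^1(A))=\bigoplus_{n\ge 0}T^n_A(\Omega^1(A))$ be its tensor algebra over $A$, where for an $A$-bimodule $M$ one puts $T^0_A(M)=A$, $T^1_A(M)=M$ and $T^n_A(M)=M\otimes_A\cdots\otimes_A M$ ($n$ factors) for $n\ge 2$, with concatenation of tensors as product. Let $\bar A=A/K\cdot 1$, with projection $a\mapsto\bar a$, and let $\mathcal D(A)=\bigoplus_{n\ge 0}\mathcal D(A)_n$ with $\mathcal D(A)_n=A\otimes\bar A^{\otimes n}$ be the Cuntz–Quillen universal differential envelope, with product $\mathcal D(A)_n\times\mathcal D(A)_{m-1-n}\to\mathcal D(A)_{m-1}$ $$(a_0\otimes\bar a_1\otimes\cdots\otimes\bar a_n)(a_{n+1}\otimes\bar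 a_{n+2}\otimes\cdots\otimes\bar a_m)=(-1)^n a_0a_1\otimes\bar a_2\otimes\cdots\otimes\bar a_m+\sum_{i=1}^n(-1)^{n-i}a_0\otimes\bar a_1\otimes\cdots\otimes\overline{a_ia_{i+1}}\otimes\cdots\otimes\bar a_m$$ and differential $d(a_0\otimes\bar a_1\otimes\cdots\otimes\bar a_n)=1\otimes\bar a_0\otimes\bar a_1\otimes\cdots\otimes\bar a_n$. Then $\Omega^\bullet(A)$ and $\mathcal D(A)$ are isomorphic as graded $K$-algebras. More precisely, there is an isomorphism of graded $K$-algebras $\Psi\colon\Omega^\bullet(A)\to\mathcal D(A)$ which is the identity of $A$ in degree $0$ and is given in degree $1$ by $\Psi(a.db)=a\otimes\bar b$; its inverse satisfies $$\Psi^{-1}(a_0\otimes\bar a_1\otimes\cdots\otimes\bar a_n)=a_0.da_1\otimes_A da_2\otimes_A\cdots\otimes_A da_n .$$ Moreover $\delta=\Psi^{-1}\circ d\circ\Psi$ makes $\Omega^\bullet(A)$ a differential graded algebra extending the universal derivation: $\delta$ has degree $1$, $\delta\circ\delta=0$, $\delta(xy)=\delta(x)y+(-1)^n x\,\delta(y)$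 for $x$ of degree $n$ and all $y$, and $\delta(a)=da$ for $a\in A$. -/

import Mathlib

open scoped TensorProduct DirectSum

universe u v w

noncomputable section

set_option linter.unusedSectionVars false

namespace AssocGeom

/-! ## Two general tools: algebras from left multiplication operators, and graded direct sums -/

/-- A ring structure on a module from a bilinear, associative and unital multiplication, given by
its left multiplication operators `x ↦ (y ↦ x * y)`. -/
abbrev ringOfLeftMul {K : Type u} {X : Type w} [CommRing K] [AddCommGroup X] [Module K X]
    (e : X) (L : X →ₗ[K] Module.End K X) (one_mul : L e = 1) (mul_one : ∀ x, L x e = x)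
    (mul_assoc : ∀ x y, L (L x y) = L x * L y) : Ring X :=
  { (inferInstance : AddCommGroup X) with
    one := e
    mul := fun x y => L x y
    one_mul := fun x => by
      change L e x = x
      rw [one_mul]; rfl
    mul_one := mul_one
    mul_assoc := fun x y z => LinearMap.congr_fun (mul_assoc x y) z
    left_distrib := fun x y z => map_add (L x) y z
    right_distrib := fun x y z => by
      change L (x + y) z = L x z + L y z
      rw [map_add]; rfl
    zero_mul := fun x => by
      change L 0 x = 0
      rw [map_zero]; rfl
    mul_zero := fun x => map_zero (L x) }

/-- The summands of a direct sum of modules, as submodules. -/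
def summand (K : Type u) [CommRing K] (X : ℕ → Type w) [∀ n, AddCommGroup (X n)]
    [∀ n, Module K (X n)] (n : ℕ) : Submodule K (⨁ n, X n) :=
  LinearMap.range (DirectSum.lof K ℕ X n)

/-- A direct sum decomposes into its summands. -/
abbrev summandDecomposition (K : Type u) [CommRing K] (X : ℕ → Type w) [∀ n, AddCommGroup (X n)]
    [∀ n, Module K (X n)] : DirectSum.Decomposition (summand K X) :=
  DirectSum.Decomposition.ofLinearMap (summand K X)
    (DirectSum.toModule K ℕ _ fun n =>
      DirectSum.lof K ℕ (fun n => summand K X n) n ∘ₗ (DirectSum.lof K ℕ X n).rangeRestrict)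
    (by
      ext n x : 2
      simp only [LinearMap.comp_apply, DirectSum.toModule_lof, LinearMap.id_apply]
      exact DirectSum.coeLinearMap_lof _ _ _)
    (by
      ext n x : 2
      obtain ⟨_, y, rfl⟩ := x
      simp only [LinearMap.comp_apply, LinearMap.id_apply, DirectSum.coeLinearMap_lof,
        DirectSum.toModule_lof]
      rfl)

/-! ## The tensor product `M ⊗_A N` of a right and a left module over a noncommutative algebra -/

section Balanced

variable (K : Type u) (A : Type v) [CommRing K] [Ring A] [Algebra K A]
  (M : Type w) [AddCommGroup M] [Module K M] [Module A M] [Module Aᵐᵒᵖ M]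
  [IsScalarTower K A M]
  (N : Type w) [AddCommGroup N] [Module K N] [Module A N]

/-- The relations `m.a ⊗ n = m ⊗ a.n` inside `M ⊗_K N`. For a bimodule `M`, the set of these
relations is stable under the left action of `A`, so that the left `A`-submodule that they span
is just the subgroup that they generate. -/
def balancedRel : Submodule A (M ⊗[K] N) :=
  Submodule.span A {x | ∃ (m : M) (a : A) (n : N),
    x = (MulOpposite.op a • m) ⊗ₜ[K] n - m ⊗ₜ[K] (a • n)}

/-- The tensor product `M ⊗_A N` of an `A`-bimodule `M` and a left `A`-module `N`, as a left
`A`-module. -/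
abbrev BalTensor : Type w := (M ⊗[K] N) ⧸ balancedRel K A M N

end Balanced

/-- A left `A`-module over the `K`-algebra `A`, bundled (used to define tensor powers by
recursion). -/
structure LeftMod (K : Type u) (A : Type v) [CommRing K] [Ring A] [Algebra K A] where
  carrier : Type v
  [addCommGroup : AddCommGroup carrier]
  [moduleK : Module K carrier]
  [moduleA : Module A carrier]
  [tower : IsScalarTower K A carrier]

attribute [instance] LeftMod.addCommGroup LeftMod.moduleK LeftMod.moduleA LeftMod.tower

/-! ## The tensor algebra of a bimodule -/

section TensorAlg

variable (K : Type u) (A : Type v) [CommRing K] [Ring A] [Algebra K A]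
  (M : Type v) [AddCommGroup M] [Module K M] [Module A M] [Module Aᵐᵒᵖ M]
  [SMulCommClass A Aᵐᵒᵖ M] [IsScalarTower K A M] [IsScalarTower K Aᵐᵒᵖ M]

/-- `T⁰ = A`, `T¹ = M`, `Tⁿ = M ⊗_A ⋯ ⊗_A M` (bracketed to the right), as left `A`-modules. -/
def tensorPowBundle : ℕ → LeftMod K A
  | 0 => ⟨A⟩
  | 1 => ⟨M⟩
  | n + 2 => ⟨BalTensor K A M (tensorPowBundle (n + 1)).carrier⟩

/-- The `n`-th tensor power `T_Aⁿ(M)` of the bimodule `M`. -/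
abbrev TPow (n : ℕ) : Type v := (tensorPowBundle K A M n).carrier

/-- `T⁰ = A`. -/
def TPow.zeroEquiv : A ≃ₗ[A] TPow K A M 0 where
  toFun a := a
  invFun a := a
  map_add' _ _ := rfl
  map_smul' _ _ := rfl

/-- `T¹ = M`. -/
def TPow.oneEquiv : M ≃ₗ[A] TPow K A M 1 where
  toFun m := m
  invFun m := m
  map_add' _ _ := rfl
  map_smul' _ _ := rfl

variable {A M}

/-- The right action of `A` on a bimodule, as a bilinear map `(m, a) ↦ m.a`. -/
def rightAct : M →ₗ[K] A →ₗ[K] M :=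
  LinearMap.mk₂ K (fun m a => MulOpposite.op a • m)
    (fun _ _ _ => smul_add _ _ _) (fun c m a => by
      rw [← algebraMap_smul A c m, ← smul_comm, algebraMap_smul])
    (fun m a b => by rw [MulOpposite.op_add, add_smul])
    (fun c m a => by rw [MulOpposite.op_smul, smul_assoc])

/-- The map `M × Tⁿ → Tⁿ⁺¹` that puts a factor on the left: `(m, a) ↦ m.a` for `n = 0`,
and `(m, t) ↦ m ⊗_A t` for `n ≥ 1`. -/
def TPow.cons : (n : ℕ) → M →ₗ[K] TPow K A M n →ₗ[K] TPow K A M (n + 1)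
  | 0 => LinearMap.compl₁₂ (rightAct K) LinearMap.id
      ((TPow.zeroEquiv K A M).symm.toLinearMap.restrictScalars K) |>.compr₂
      ((TPow.oneEquiv K A M).toLinearMap.restrictScalars K)
  | n + 1 => LinearMap.compr₂ (TensorProduct.mk K M (TPow K A M (n + 1)))
      ((balancedRel K A M (TPow K A M (n + 1))).mkQ.restrictScalars K)

theorem TPow.cons_zero (m : M) (a : A) :
    TPow.cons K 0 m (TPow.zeroEquiv K A M a) = TPow.oneEquiv K A M (MulOpposite.op a • m) := rfl

theorem TPow.cons_smul : ∀ (n : ℕ) (a : A) (m : M) (t : TPow K A M n),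
    TPow.cons K n (a • m) t = a • TPow.cons K n m t
  | 0, a, m, t => by
      obtain ⟨b, rfl⟩ := (TPow.zeroEquiv K A M).surjective t
      rw [cons_zero, cons_zero, ← map_smul, ← smul_comm]
  | _ + 1, _, _, _ => rfl

theorem TPow.cons_op : ∀ (n : ℕ) (a : A) (m : M) (t : TPow K A M n),
    TPow.cons K n (MulOpposite.op a • m) t = TPow.cons K n m (a • t)
  | 0, a, m, t => by
      obtain ⟨b, rfl⟩ := (TPow.zeroEquiv K A M).surjective t
      rw [← map_smul, cons_zero, cons_zero, smul_smul, smul_eq_mul, MulOpposite.op_mul]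
  | n + 1, a, m, t =>
      (Submodule.Quotient.eq _).2 (Submodule.subset_span ⟨m, a, t, rfl⟩)

variable {K}

/-- The universal property of `Tⁿ⁺² = M ⊗_A Tⁿ⁺¹` for balanced maps that are left `A`-linear. -/
def TPow.lift {P : Type*} [AddCommGroup P] [Module K P] [Module A P] [IsScalarTower K A P]
    (n : ℕ) (f : M →ₗ[A] TPow K A M (n + 1) →ₗ[K] P)
    (hf : ∀ (a : A) (m : M) (t : TPow K A M (n + 1)), f (MulOpposite.op a • m) t = f m (a • t)) :
    TPow K A M (n + 2) →ₗ[A] P :=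
  (balancedRel K A M (TPow K A M (n + 1))).liftQ (TensorProduct.AlgebraTensorModule.lift f) (by
    refine Submodule.span_le.2 ?_
    rintro _ ⟨m, a, t, rfl⟩
    simp [hf])

/-- `Tⁿ⁺²` is additively generated by the elements `m ⊗_A t`. -/
theorem TPow.induction {n : ℕ} {p : TPow K A M (n + 2) → Prop} (zero : p 0)
    (cons : ∀ m t, p (TPow.cons K (n + 1) m t)) (add : ∀ x y, p x → p y → p (x + y))
    (x : TPow K A M (n + 2)) : p x := by
  obtain ⟨y, rfl⟩ := Submodule.Quotient.mk_surjective _ x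
  induction y with
  | zero => exact zero
  | tmul m t => exact cons m t
  | add y z hy hz => exact add _ _ hy hz

variable (K A M)

/-- The tensor algebra `T_A(M) = ⨁ₙ T_Aⁿ(M)`. -/
def TAlg : Type v := ⨁ n, TPow K A M n

namespace TAlg

instance : AddCommGroup (TAlg K A M) := inferInstanceAs (AddCommGroup (⨁ n, TPow K A M n))
instance : Module K (TAlg K A M) := inferInstanceAs (Module K (⨁ n, TPow K A M n))
instance : Module A (TAlg K A M) := inferInstanceAs (Module A (⨁ n, TPow K A M n))
instance : IsScalarTower K A (TAlg K A M) :=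
  inferInstanceAs (IsScalarTower K A (⨁ n, TPow K A M n))

/-- The inclusion `Tⁿ → T_A(M)`. -/
def of (n : ℕ) : TPow K A M n →ₗ[K] TAlg K A M := DirectSum.lof K ℕ (TPow K A M) n

variable {K A M} in
/-- The linear map on `T_A(M)` with given restrictions to the summands `Tⁿ`. -/
def lift {P : Type*} [AddCommGroup P] [Module K P] (f : ∀ n, TPow K A M n →ₗ[K] P) :
    TAlg K A M →ₗ[K] P :=
  DirectSum.toModule K ℕ P f

variable {A M}

/-- The inclusion of degree zero, `A → T_A(M)`. -/
def ofA : A →ₗ[K] TAlg K A M :=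
  of K A M 0 ∘ₗ (TPow.zeroEquiv K A M).toLinearMap.restrictScalars K

/-- The inclusion of degree one, `M → T_A(M)`. -/
def ofM : M →ₗ[K] TAlg K A M :=
  of K A M 1 ∘ₗ (TPow.oneEquiv K A M).toLinearMap.restrictScalars K

variable {K}

theorem ofA_apply (a : A) : ofA K a = of K A M 0 (TPow.zeroEquiv K A M a) := rfl

theorem ofM_apply (m : M) : ofM K m = of K A M 1 (TPow.oneEquiv K A M m) := rfl

theorem lift_of {P : Type*} [AddCommGroup P] [Module K P] (f : ∀ n, TPow K A M n →ₗ[K] P)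
    (n : ℕ) (t : TPow K A M n) : lift f (of K A M n t) = f n t :=
  DirectSum.toModule_lof _ _ _

theorem induction {p : TAlg K A M → Prop} (zero : p 0) (of : ∀ n t, p (of K A M n t))
    (add : ∀ x y, p x → p y → p (x + y)) (x : TAlg K A M) : p x :=
  DirectSum.induction_on x zero of add

theorem smul_of (a : A) (n : ℕ) (t : TPow K A M n) : a • of K A M n t = of K A M n (a • t) :=
  (map_smul (DirectSum.lof A ℕ (TPow K A M) n) a t).symm

/-- Left multiplication by `m ∈ M` on the tensor algebra, `t ↦ m ⊗_A t`. -/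
def mulM : M →ₗ[A] Module.End K (TAlg K A M) where
  toFun m := lift fun n => of K A M (n + 1) ∘ₗ TPow.cons K n m
  map_add' m m' := by
    refine LinearMap.ext fun x => ?_
    induction x using TAlg.induction with
    | zero => simp
    | of n t => simp only [LinearMap.add_apply, lift_of, LinearMap.comp_apply, map_add]
    | add x y hx hy => rw [map_add, map_add, hx, hy]
  map_smul' a m := by
    refine LinearMap.ext fun x => ?_
    induction x using TAlg.induction with
    | zero => simp
    | of n t => simp only [LinearMap.smul_apply, lift_of, LinearMap.comp_apply, TPow.cons_smul,
        smul_of, RingHom.id_apply]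
    | add x y hx hy => rw [map_add, map_add, hx, hy]

theorem mulM_of (m : M) (n : ℕ) (t : TPow K A M n) :
    mulM m (of K A M n t) = of K A M (n + 1) (TPow.cons K n m t) :=
  lift_of _ _ _

theorem mulM_op (a : A) (m : M) (x : TAlg K A M) : mulM (MulOpposite.op a • m) x = mulM m (a • x) := by
  induction x using TAlg.induction with
  | zero => simp
  | of n t => rw [smul_of, mulM_of, mulM_of, TPow.cons_op]
  | add x y hx hy => rw [smul_add, map_add, map_add, hx, hy]

/-- Left multiplication by a homogeneous element: `a · x` is the left action of `a ∈ A = T⁰`,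
and `(m₁ ⊗_A ⋯ ⊗_A mₙ) · x = m₁ ⊗_A (⋯ (mₙ ⊗_A x))`. -/
def mulTPow : (n : ℕ) → TPow K A M n →ₗ[A] Module.End K (TAlg K A M)
  | 0 => LinearMap.toSpanSingleton A (Module.End K (TAlg K A M)) 1 ∘ₗ
      (TPow.zeroEquiv K A M).symm.toLinearMap
  | 1 => mulM ∘ₗ (TPow.oneEquiv K A M).symm.toLinearMap
  | n + 2 => TPow.lift n
      { toFun := fun m => LinearMap.mulLeft K (mulM m) ∘ₗ (mulTPow (n + 1)).restrictScalars K
        map_add' := fun m m' => by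
          ext t x
          simp [add_mul]
        map_smul' := fun a m => by
          ext t x
          simp }
      (fun a m t => LinearMap.ext fun x => by
        change mulM (MulOpposite.op a • m) (mulTPow (n + 1) t x)
          = mulM m (mulTPow (n + 1) (a • t) x)
        rw [mulM_op, map_smul (mulTPow (n + 1))]
        rfl)

theorem mulTPow_zero (a : A) (x : TAlg K A M) :
    mulTPow 0 (TPow.zeroEquiv K A M a) x = a • x := rfl

theorem mulTPow_oneEquiv (m : M) : mulTPow 1 (TPow.oneEquiv K A M m) = mulM (K := K) m := rfl

theorem mulTPow_cons : ∀ (n : ℕ) (m : M) (t : TPow K A M n),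
    mulTPow (n + 1) (TPow.cons K n m t) = mulM m * mulTPow n t
  | 0, m, t => by
      obtain ⟨a, rfl⟩ := (TPow.zeroEquiv K A M).surjective t
      refine LinearMap.ext fun x => ?_
      rw [TPow.cons_zero, Module.End.mul_apply, mulTPow_zero, ← mulM_op]
      rfl
  | _ + 1, _, _ => rfl

variable (K A M) in
/-- The multiplication of the tensor algebra, as its left multiplication operators. -/
def mulLeft : TAlg K A M →ₗ[K] Module.End K (TAlg K A M) :=
  lift fun n => (mulTPow n).restrictScalars K

theorem mulLeft_of (n : ℕ) (t : TPow K A M n) : mulLeft K A M (of K A M n t) = mulTPow n t :=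
  lift_of _ _ _

theorem mulLeft_smul (a : A) (x : TAlg K A M) : mulLeft K A M (a • x) = a • mulLeft K A M x := by
  induction x using TAlg.induction with
  | zero => simp
  | of n t => rw [smul_of, mulLeft_of, mulLeft_of, map_smul]
  | add x y hx hy => rw [smul_add, map_add, map_add, hx, hy, smul_add]

theorem mulLeft_mulM (m : M) (x : TAlg K A M) :
    mulLeft K A M (mulM m x) = mulM m * mulLeft K A M x := by
  induction x using TAlg.induction with
  | zero => simp
  | of n t => rw [mulM_of, mulLeft_of, mulLeft_of, mulTPow_cons]
  | add x y hx hy => rw [map_add, map_add, map_add, hx, hy, mul_add]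

theorem mulTPow_assoc : ∀ (n : ℕ) (t : TPow K A M n) (y : TAlg K A M),
    mulLeft K A M (mulTPow n t y) = mulTPow n t * mulLeft K A M y
  | 0, t, y => by
      obtain ⟨a, rfl⟩ := (TPow.zeroEquiv K A M).surjective t
      rw [mulTPow_zero, mulLeft_smul]
      rfl
  | 1, t, y => by
      obtain ⟨m, rfl⟩ := (TPow.oneEquiv K A M).surjective t
      rw [mulTPow_oneEquiv, mulLeft_mulM]
  | n + 2, t, y => by
      induction t using TPow.induction with
      | zero => simp
      | cons m t =>
        rw [mulTPow_cons, Module.End.mul_apply, mulLeft_mulM, mulTPow_assoc (n + 1) t y, mul_assoc]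
      | add s t hs ht => rw [map_add, LinearMap.add_apply, map_add, hs, ht, add_mul]

theorem mulTPow_one : ∀ (n : ℕ) (t : TPow K A M n), mulTPow n t (ofA K (1 : A)) = of K A M n t
  | 0, t => by
      obtain ⟨a, rfl⟩ := (TPow.zeroEquiv K A M).surjective t
      rw [mulTPow_zero, ofA_apply, smul_of, ← map_smul, smul_eq_mul, mul_one]
  | 1, t => by
      obtain ⟨m, rfl⟩ := (TPow.oneEquiv K A M).surjective t
      rw [mulTPow_oneEquiv, ofA_apply, mulM_of, TPow.cons_zero, MulOpposite.op_one, one_smul]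
  | n + 2, t => by
      induction t using TPow.induction with
      | zero => simp
      | cons m t => rw [mulTPow_cons, Module.End.mul_apply, mulTPow_one (n + 1) t, mulM_of]
      | add s t hs ht => rw [map_add, LinearMap.add_apply, map_add, hs, ht]

/-- The tensor algebra is a ring: concatenation of tensors, with unit `1 ∈ A = T⁰`. -/
instance : Ring (TAlg K A M) :=
  ringOfLeftMul (ofA K (1 : A)) (mulLeft K A M)
    (by
      rw [ofA_apply, mulLeft_of]
      exact LinearMap.ext fun x => one_smul A x)
    (fun x => by
      induction x using TAlg.induction with
      | zero => simp
      | of n t => rw [mulLeft_of, mulTPow_one]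
      | add x y hx hy => rw [map_add, LinearMap.add_apply, hx, hy])
    (fun x y => by
      induction x using TAlg.induction with
      | zero => simp
      | of n t => rw [mulLeft_of, mulTPow_assoc]
      | add x x' hx hx' => rw [map_add, LinearMap.add_apply, map_add, hx, hx', add_mul])

theorem mul_def (x y : TAlg K A M) : x * y = mulLeft K A M x y := rfl

instance : Algebra K (TAlg K A M) :=
  Algebra.ofModule
    (fun c x y => by rw [mul_def, map_smul]; rfl)
    (fun c x y => by rw [mul_def, map_smul]; rfl)

theorem ofA_mul (a : A) (x : TAlg K A M) : ofA K a * x = a • x := by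
  rw [mul_def, ofA_apply, mulLeft_of, mulTPow_zero]

theorem ofM_mul_of (m : M) (n : ℕ) (t : TPow K A M n) :
    ofM K m * of K A M n t = of K A M (n + 1) (TPow.cons K n m t) := by
  rw [mul_def, ofM_apply, mulLeft_of, mulTPow_oneEquiv, mulM_of]

variable (K A M) in
/-- The homogeneous component `T_Aⁿ(M)` of the tensor algebra. -/
def grade (n : ℕ) : Submodule K (TAlg K A M) := summand K (TPow K A M) n

theorem mul_mem_grade : ∀ (i j : ℕ) (s : TPow K A M i) (t : TPow K A M j),
    of K A M i s * of K A M j t ∈ grade K A M (i + j)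
  | 0, j, s, t => by
      obtain ⟨a, rfl⟩ := (TPow.zeroEquiv K A M).surjective s
      rw [Nat.zero_add, ← ofA_apply, ofA_mul, smul_of]
      exact ⟨a • t, rfl⟩
  | 1, j, s, t => by
      obtain ⟨m, rfl⟩ := (TPow.oneEquiv K A M).surjective s
      rw [Nat.add_comm, ← ofM_apply, ofM_mul_of]
      exact ⟨TPow.cons K j m t, rfl⟩
  | i + 2, j, s, t => by
      induction s using TPow.induction with
      | zero => simp
      | cons m s =>
        obtain ⟨r, hr⟩ := mul_mem_grade (i + 1) j s t
        rw [← ofM_mul_of, mul_assoc, ← hr, show i + 2 + j = i + 1 + j + 1 by omega]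
        exact ⟨TPow.cons K _ m r, (ofM_mul_of m _ r).symm⟩
      | add s s' hs hs' => rw [map_add, add_mul]; exact add_mem hs hs'

instance : GradedAlgebra (grade K A M) where
  one_mem := ⟨_, rfl⟩
  mul_mem := by
    rintro i j _ _ ⟨s, rfl⟩ ⟨t, rfl⟩
    exact mul_mem_grade i j s t
  toDecomposition := summandDecomposition K (TPow K A M)

end TAlg

end TensorAlg

/-! ## Noncommutative Kähler differentials -/

section Kahler

variable (K : Type u) (A : Type v) [CommRing K] [Ring A] [Algebra K A]

/-- The bimodule `Ω¹(A)` of noncommutative Kähler differentials of `A`: the kernel of the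
multiplication map `A ⊗ A → A`. -/
def Omega1 : Type v := LinearMap.ker (LinearMap.mul' K A)

namespace Omega1

instance : AddCommGroup (Omega1 K A) :=
  inferInstanceAs (AddCommGroup (LinearMap.ker (LinearMap.mul' K A)))
instance : Module K (Omega1 K A) :=
  inferInstanceAs (Module K (LinearMap.ker (LinearMap.mul' K A)))

variable {K A}

/-- The underlying element of `A ⊗ A`. -/
def val : Omega1 K A →ₗ[K] A ⊗[K] A := (LinearMap.ker (LinearMap.mul' K A)).subtype

theorem val_injective : Function.Injective (val : Omega1 K A → A ⊗[K] A) :=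
  Subtype.val_injective

theorem mul'_val (ω : Omega1 K A) : LinearMap.mul' K A (val ω) = 0 := ω.2

variable (K) in
/-- The left action `a.(a' ⊗ a'') = aa' ⊗ a''` on `A ⊗ A`. -/
def leftMul (a : A) : A ⊗[K] A →ₗ[K] A ⊗[K] A := (LinearMap.mulLeft K a).rTensor A

variable (K) in
/-- The right action `(a' ⊗ a'').b = a' ⊗ a''b` on `A ⊗ A`. -/
def rightMul (b : A) : A ⊗[K] A →ₗ[K] A ⊗[K] A := (LinearMap.mulRight K b).lTensor A

theorem mul'_leftMul (a : A) (x : A ⊗[K] A) :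
    LinearMap.mul' K A (leftMul K a x) = a * LinearMap.mul' K A x := by
  induction x with
  | zero => simp
  | tmul b c => simp [leftMul, mul_assoc]
  | add x y hx hy => rw [map_add, map_add, map_add, hx, hy, mul_add]

theorem mul'_rightMul (a : A) (x : A ⊗[K] A) :
    LinearMap.mul' K A (rightMul K a x) = LinearMap.mul' K A x * a := by
  induction x with
  | zero => simp
  | tmul b c => simp [rightMul, mul_assoc]
  | add x y hx hy => rw [map_add, map_add, map_add, hx, hy, add_mul]

instance : SMul A (Omega1 K A) where
  smul a ω := ⟨leftMul K a (val ω), by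
    rw [LinearMap.mem_ker, mul'_leftMul, mul'_val, mul_zero]⟩

instance : SMul Aᵐᵒᵖ (Omega1 K A) where
  smul b ω := ⟨rightMul K b.unop (val ω), by
    rw [LinearMap.mem_ker, mul'_rightMul, mul'_val, zero_mul]⟩

theorem val_smul (a : A) (ω : Omega1 K A) : val (a • ω) = leftMul K a (val ω) := rfl

theorem val_op_smul (b : A) (ω : Omega1 K A) :
    val (MulOpposite.op b • ω) = rightMul K b (val ω) := rfl

instance : Module A (Omega1 K A) where
  one_smul ω := val_injective (by rw [val_smul]; simp [leftMul])
  mul_smul a b ω := val_injective (by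
    simp only [val_smul, leftMul, LinearMap.mulLeft_mul, LinearMap.rTensor_comp]; rfl)
  smul_zero a := val_injective (by rw [val_smul]; simp)
  smul_add a ω η := val_injective (by simp only [val_smul, map_add])
  add_smul a b ω := val_injective (by
    rw [map_add]
    simp only [val_smul, leftMul, ← LinearMap.add_apply, ← LinearMap.rTensor_add]
    congr 2
    ext
    simp [add_mul])
  zero_smul ω := val_injective (by rw [val_smul]; simp [leftMul])

instance : Module Aᵐᵒᵖ (Omega1 K A) where
  one_smul ω := val_injective (by
    rw [← MulOpposite.op_one, val_op_smul]; simp [rightMul])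
  mul_smul a b ω := val_injective (by
    induction a; induction b
    rw [← MulOpposite.op_mul]
    simp only [val_op_smul, rightMul, LinearMap.mulRight_mul, LinearMap.lTensor_comp]; rfl)
  smul_zero a := val_injective (by induction a; rw [val_op_smul]; simp)
  smul_add a ω η := val_injective (by induction a; simp only [val_op_smul, map_add])
  add_smul a b ω := val_injective (by
    induction a; induction b
    rw [← MulOpposite.op_add, map_add]
    simp only [val_op_smul, rightMul, ← LinearMap.add_apply, ← LinearMap.lTensor_add]
    congr 2
    ext
    simp [mul_add])
  zero_smul ω := val_injective (by
    rw [← MulOpposite.op_zero, val_op_smul]; simp [rightMul])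

instance : SMulCommClass A Aᵐᵒᵖ (Omega1 K A) where
  smul_comm a b ω := val_injective (by
    induction b
    rw [val_smul, val_op_smul, val_op_smul, val_smul]
    rw [leftMul, rightMul]
    exact LinearMap.congr_fun ((LinearMap.rTensor_comp_lTensor _ _ _).trans
      (LinearMap.lTensor_comp_rTensor _ _ _).symm) (val ω))

instance : IsScalarTower K A (Omega1 K A) where
  smul_assoc c a ω := val_injective (by
    rw [LinearMap.map_smul, val_smul, val_smul, leftMul, leftMul, ← LinearMap.smul_apply,
      ← LinearMap.rTensor_smul]
    congr 2
    ext
    simp)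

instance : IsScalarTower K Aᵐᵒᵖ (Omega1 K A) where
  smul_assoc c b ω := val_injective (by
    induction b
    rw [LinearMap.map_smul, ← MulOpposite.op_smul, val_op_smul, val_op_smul, rightMul, rightMul,
      ← LinearMap.smul_apply, ← LinearMap.lTensor_smul]
    congr 2
    ext
    simp)

variable (K) in
/-- The universal derivation `da = 1 ⊗ a - a ⊗ 1`. -/
def d : A →ₗ[K] Omega1 K A where
  toFun a := ⟨1 ⊗ₜ a - a ⊗ₜ 1, by simp⟩
  map_add' a b := val_injective (by
    change (1 : A) ⊗ₜ[K] (a + b) - (a + b) ⊗ₜ[K] (1 : A)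
      = (1 ⊗ₜ a - a ⊗ₜ 1) + (1 ⊗ₜ b - b ⊗ₜ 1)
    rw [TensorProduct.tmul_add, TensorProduct.add_tmul]
    abel)
  map_smul' c a := val_injective (by
    change (1 : A) ⊗ₜ[K] (c • a) - (c • a) ⊗ₜ[K] (1 : A) = c • (1 ⊗ₜ a - a ⊗ₜ 1)
    rw [TensorProduct.tmul_smul, smul_sub, TensorProduct.smul_tmul' c a])

end Omega1

/-- The algebra `Ω•(A) = T_A(Ω¹(A))`. -/
abbrev OmegaAlg : Type v := TAlg K A (Omega1 K A)

end Kahler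

/-! ## The universal differential envelope -/

section Envelope

variable (K : Type u) (A : Type v) [CommRing K] [Ring A] [Algebra K A]

/-- The quotient space `Ā = A / K·1`. -/
abbrev Bar : Type v := A ⧸ LinearMap.range (Algebra.linearMap K A)

variable {A} in
/-- The canonical projection `a ↦ ā`. -/
def bar : A →ₗ[K] Bar K A := (LinearMap.range (Algebra.linearMap K A)).mkQ

variable {A} in
theorem bar_one : bar K (1 : A) = 0 :=
  (Submodule.Quotient.mk_eq_zero _).2 ⟨1, by simp⟩

/-- The homogeneous component `D(A)ₙ = A ⊗ Ā^{⊗n}`. -/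
abbrev EnvDeg (n : ℕ) : Type (max u v) := A ⊗[K] (⨂[K]^n (Bar K A))

/-- The universal differential envelope `D(A) = ⨁ₙ A ⊗ Ā^{⊗n}`. -/
def Env : Type (max u v) := ⨁ n, EnvDeg K A n

namespace Env

instance : AddCommGroup (Env K A) := inferInstanceAs (AddCommGroup (⨁ n, EnvDeg K A n))
instance : Module K (Env K A) := inferInstanceAs (Module K (⨁ n, EnvDeg K A n))

/-- The inclusion `D(A)ₙ → D(A)`. -/
def of (n : ℕ) : EnvDeg K A n →ₗ[K] Env K A := DirectSum.lof K ℕ (EnvDeg K A) n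

variable {K A}

/-- The linear map on `D(A)` with given restrictions to the summands `D(A)ₙ`. -/
def lift {P : Type*} [AddCommGroup P] [Module K P] (f : ∀ n, EnvDeg K A n →ₗ[K] P) :
    Env K A →ₗ[K] P :=
  DirectSum.toModule K ℕ P f

theorem lift_of {P : Type*} [AddCommGroup P] [Module K P] (f : ∀ n, EnvDeg K A n →ₗ[K] P)
    (n : ℕ) (t : EnvDeg K A n) : lift f (of K A n t) = f n t :=
  DirectSum.toModule_lof _ _ _

variable (K) in
/-- The element `a₀ ⊗ ā₁ ⊗ ⋯ ⊗ āₙ` of `D(A)`, written with a sequence `a₀, a₁, …` of which only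
the first `n + 1` terms matter. -/
def elem (n : ℕ) (a : ℕ → A) : Env K A :=
  of K A n (a 0 ⊗ₜ PiTensorProduct.tprod K fun i : Fin n => bar K (a (i + 1)))

theorem of_mem_span (n : ℕ) (t : EnvDeg K A n) :
    of K A n t ∈ Submodule.span K (Set.range (elem (A := A) K n)) := by
  refine TensorProduct.induction_on t (by simp) (fun a t => ?_) (fun s t hs ht => ?_)
  · induction t using PiTensorProduct.induction_on with
    | smul_tprod c t =>
      choose b hb using fun i => Submodule.mkQ_surjective _ (t i)
      have h := Submodule.smul_mem _ c (Submodule.subset_span (R := K)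
        (Set.mem_range_self (f := elem (A := A) K n)
          fun i => if i = 0 then a else if h : i - 1 < n then b ⟨i - 1, h⟩ else 0))
      rw [elem, ← map_smul, ← TensorProduct.tmul_smul] at h
      simpa [bar, hb] using h
    | add s t hs ht => rw [TensorProduct.tmul_add, map_add]; exact add_mem hs ht
  · rw [map_add]; exact add_mem hs ht

/-- `D(A)` is spanned by the elements `a₀ ⊗ ā₁ ⊗ ⋯ ⊗ āₙ`. -/
theorem induction {p : Env K A → Prop} (elem : ∀ n a, p (elem K n a))
    (smul : ∀ (c : K) x, p x → p (c • x))
    (add : ∀ x y, p x → p y → p (x + y)) (x : Env K A) : p x := by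
  have zero : p 0 := by simpa using smul 0 _ (elem 0 0)
  refine DirectSum.induction_on x zero (fun n t => ?_) add
  refine Submodule.span_induction (p := fun x _ => p x) ?_ zero (fun x y _ _ => add x y)
    (fun c x _ => smul c x) (of_mem_span n t)
  rintro _ ⟨a, rfl⟩
  exact elem n a

theorem hom_ext {P : Type*} [AddCommGroup P] [Module K P] {f g : Env K A →ₗ[K] P}
    (h : ∀ n a, f (elem K n a) = g (elem K n a)) : f = g := by
  refine LinearMap.ext fun x => ?_
  induction x using Env.induction with
  | elem n a => exact h n a
  | smul c x hx => rw [map_smul, map_smul, hx]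
  | add x y hx hy => rw [map_add, map_add, hx, hy]

variable (K) in
/-- The map `(v, t) ↦ v ⊗ t` from `Ā × Ā^{⊗n}` to `Ā^{⊗(n+1)}`. -/
def consBar (n : ℕ) : Bar K A →ₗ[K] (⨂[K]^n (Bar K A)) →ₗ[K] ⨂[K]^(n + 1) (Bar K A) :=
  (PiTensorProduct.lift (R := K) (s := fun _ : Fin n => Bar K A)).toLinearMap ∘ₗ
    (PiTensorProduct.tprod K (s := fun _ : Fin (n + 1) => Bar K A)).curryLeft

theorem consBar_tprod (n : ℕ) (v : Bar K A) (t : Fin n → Bar K A) :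
    consBar K n v (PiTensorProduct.tprod K t)
      = PiTensorProduct.tprod K (Fin.cons v t : Fin (n + 1) → Bar K A) :=
  PiTensorProduct.lift.tprod _

variable (K A) in
/-- The differential `a₀ ⊗ ā₁ ⊗ ⋯ ⊗ āₙ ↦ 1 ⊗ ā₀ ⊗ ā₁ ⊗ ⋯ ⊗ āₙ`. -/
def d : Env K A →ₗ[K] Env K A :=
  lift fun n => TensorProduct.lift
    ((consBar K n ∘ₗ bar K).compr₂ (of K A (n + 1) ∘ₗ TensorProduct.mk K A _ 1))

/-- The sequence `b, a₀, a₁, …`. -/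
def consSeq (b : A) (a : ℕ → A) : ℕ → A
  | 0 => b
  | i + 1 => a i

theorem d_elem (n : ℕ) (a : ℕ → A) : d K A (elem K n a) = elem K (n + 1) (consSeq 1 a) := by
  rw [d, elem, lift_of, TensorProduct.lift.tmul, LinearMap.compr₂_apply, LinearMap.comp_apply]
  simp only [LinearMap.comp_apply]
  rw [consBar_tprod, elem, TensorProduct.mk_apply]
  congr 3
  ext i
  refine Fin.cases rfl (fun i => rfl) i

variable (K) in
/-- The left action of `A` on `D(A)`, `a · (a₀ ⊗ ā₁ ⊗ ⋯ ⊗ āₙ) = aa₀ ⊗ ā₁ ⊗ ⋯ ⊗ āₙ`. -/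
def mulA : A →ₗ[K] Module.End K (Env K A) where
  toFun a := lift fun n => of K A n ∘ₗ (LinearMap.mulLeft K a).rTensor _
  map_add' a b := hom_ext fun n c => by
    simp only [elem, LinearMap.add_apply, lift_of, LinearMap.comp_apply, LinearMap.rTensor_tmul,
      LinearMap.mulLeft_apply, add_mul, TensorProduct.add_tmul, map_add]
  map_smul' a b := hom_ext fun n c => by
    simp only [elem, LinearMap.smul_apply, lift_of, LinearMap.comp_apply, LinearMap.rTensor_tmul,
      LinearMap.mulLeft_apply, smul_mul_assoc, ← TensorProduct.smul_tmul', map_smul,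
      RingHom.id_apply]

theorem mulA_elem (a : A) (n : ℕ) (b : ℕ → A) :
    mulA K a (elem K n b) = elem K n (consSeq (a * b 0) fun i => b (i + 1)) :=
  lift_of _ _ _

theorem mulA_mul (a b : A) : mulA K (a * b) = mulA K a * mulA K b :=
  hom_ext fun n c => by
    rw [Module.End.mul_apply, mulA_elem, mulA_elem, mulA_elem, mul_assoc]
    rfl

theorem elem_congr {n : ℕ} {a b : ℕ → A} (h : ∀ i ≤ n, a i = b i) : elem K n a = elem K n b := by
  rw [elem, elem, h 0 (Nat.zero_le _)]
  congr 3
  ext i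
  rw [h _ i.2]

theorem mulA_one : mulA K (1 : A) = 1 :=
  hom_ext fun n c => by
    rw [mulA_elem, one_mul]
    refine elem_congr fun i _ => ?_
    cases i <;> rfl

theorem mulA_algebraMap (c : K) : mulA K (algebraMap K A c) = c • 1 := by
  rw [Algebra.algebraMap_eq_smul_one, map_smul, mulA_one]

variable (K A) in
/-- Left multiplication by `dā = 1 ⊗ ā` on `D(A)`, `x ↦ d(ax) - a d(x)`; that is,
`(1 ⊗ ā)(a₀ ⊗ ā₁ ⊗ ⋯ ⊗ āₙ) = - a ⊗ ā₀ ⊗ ⋯ ⊗ āₙ + 1 ⊗ \overline{aa₀} ⊗ ā₁ ⊗ ⋯ ⊗ āₙ`. -/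
def mulD : Bar K A →ₗ[K] Module.End K (Env K A) :=
  (LinearMap.range (Algebra.linearMap K A)).liftQ
    (LinearMap.mulLeft K (d K A) ∘ₗ mulA K - LinearMap.mulRight K (d K A) ∘ₗ mulA K) (by
      rintro _ ⟨c, rfl⟩
      simp [mulA_algebraMap])

theorem mulD_bar (a : A) : mulD K A (bar K a) = d K A * mulA K a - mulA K a * d K A := rfl

theorem mulD_elem (a : A) (n : ℕ) (b : ℕ → A) : mulD K A (bar K a) (elem K n b)
    = elem K (n + 1) (consSeq 1 (consSeq (a * b 0) fun i => b (i + 1)))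
      - elem K (n + 1) (consSeq a b) := by
  rw [mulD_bar, LinearMap.sub_apply, Module.End.mul_apply, Module.End.mul_apply, mulA_elem,
    d_elem, d_elem, mulA_elem]
  congr 2
  funext i
  cases i <;> simp [consSeq]

theorem mulD_mul_mulA (a b : A) : mulD K A (bar K a) * mulA K b
    = mulD K A (bar K (a * b)) - mulA K a * mulD K A (bar K b) := by
  simp only [mulD_bar, mulA_mul]
  noncomm_ring

/-- Left multiplication by `a₀ ⊗ ā₁ ⊗ ⋯ ⊗ āₙ = a₀ (1 ⊗ ā₁) ⋯ (1 ⊗ āₙ)` on `D(A)`. -/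
def mulDeg (n : ℕ) : EnvDeg K A n →ₗ[K] Module.End K (Env K A) :=
  TensorProduct.lift ((LinearMap.mul K (Module.End K (Env K A))).compl₁₂ (mulA K)
    (PiTensorProduct.lift ((MultilinearMap.mkPiAlgebraFin K n (Module.End K (Env K A))).compLinearMap
      fun _ => mulD K A)))

variable (K A) in
/-- The multiplication of `D(A)`, as its left multiplication operators. -/
def mulLeft : Env K A →ₗ[K] Module.End K (Env K A) := lift mulDeg

variable (K) in
/-- The operator of left multiplication by `(1 ⊗ ā₀) ⋯ (1 ⊗ āₙ₋₁)`. -/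
def mulSeq : (n : ℕ) → (ℕ → A) → Module.End K (Env K A)
  | 0, _ => 1
  | n + 1, a => mulD K A (bar K (a 0)) * mulSeq n fun i => a (i + 1)

theorem prod_ofFn_mulD : ∀ (n : ℕ) (a : ℕ → A),
    (List.ofFn fun i : Fin n => mulD K A (bar K (a i))).prod = mulSeq K n a
  | 0, _ => rfl
  | n + 1, a => by
    rw [List.ofFn_succ, List.prod_cons, mulSeq, ← prod_ofFn_mulD n]
    rfl

theorem mulLeft_elem (n : ℕ) (a : ℕ → A) :
    mulLeft K A (elem K n a) = mulA K (a 0) * mulSeq K n fun i => a (i + 1) := by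
  rw [mulLeft, elem, lift_of, mulDeg, TensorProduct.lift.tmul, LinearMap.compl₁₂_apply,
    PiTensorProduct.lift.tprod, LinearMap.mul_apply', ← prod_ofFn_mulD]
  rfl

theorem mulLeft_mulA (a : A) (x : Env K A) :
    mulLeft K A (mulA K a x) = mulA K a * mulLeft K A x := by
  induction x using Env.induction with
  | elem n b => rw [mulA_elem, mulLeft_elem, mulLeft_elem, ← mul_assoc, ← mulA_mul]; rfl
  | smul c x hx => rw [map_smul, map_smul, hx, map_smul, mul_smul_comm]
  | add x y hx hy => rw [map_add, map_add, hx, hy, map_add, mul_add]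

theorem mulLeft_mulD (a : A) (x : Env K A) :
    mulLeft K A (mulD K A (bar K a) x) = mulD K A (bar K a) * mulLeft K A x := by
  induction x using Env.induction with
  | elem n b =>
    rw [mulD_elem, map_sub, mulLeft_elem, mulLeft_elem, mulLeft_elem, ← mul_assoc, mulD_mul_mulA]
    simp only [consSeq, mulA_one, mulSeq, one_mul, sub_mul, mul_assoc]
  | smul c x hx => rw [map_smul, map_smul, hx, map_smul, mul_smul_comm]
  | add x y hx hy => rw [map_add, map_add, hx, hy, map_add, mul_add]

theorem mulLeft_mulSeq (n : ℕ) (a : ℕ → A) (x : Env K A) :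
    mulLeft K A (mulSeq K n a x) = mulSeq K n a * mulLeft K A x := by
  induction n generalizing a with
  | zero => simp [mulSeq]
  | succ n ih => rw [mulSeq, Module.End.mul_apply, mulLeft_mulD, ih, mul_assoc]

theorem elem_eq_zero {n : ℕ} {a : ℕ → A} (i : Fin n) (h : a (i + 1) = 1) : elem K n a = 0 := by
  rw [elem, MultilinearMap.map_coord_zero _ i (by rw [h, bar_one]), TensorProduct.tmul_zero,
    map_zero]

theorem mulSeq_one (n : ℕ) (a : ℕ → A) :
    mulSeq K n a (elem K 0 1) = elem K n (consSeq 1 a) := by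
  induction n generalizing a with
  | zero => exact elem_congr fun i hi => by rw [Nat.le_zero.1 hi]; rfl
  | succ n ih =>
    rw [mulSeq, Module.End.mul_apply, ih, mulD_elem]
    rw [elem_eq_zero (a := consSeq (a 0) _) (0 : Fin (n + 1)) rfl, sub_zero]
    congr 1
    funext i
    rcases i with _ | _ | i <;> simp [consSeq]

/-- `D(A)` is a ring. -/
instance : Ring (Env K A) :=
  ringOfLeftMul (elem K 0 1) (mulLeft K A)
    (by
      rw [mulLeft_elem]
      exact congrArg (· * 1) mulA_one)
    (fun x => by
      induction x using Env.induction with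
      | elem n a =>
        rw [mulLeft_elem, Module.End.mul_apply, mulSeq_one, mulA_elem]
        refine elem_congr fun i _ => ?_
        cases i <;> simp [consSeq]
      | smul c x hx => rw [map_smul, LinearMap.smul_apply, hx]
      | add x y hx hy => rw [map_add, LinearMap.add_apply, hx, hy])
    (fun x y => by
      induction x using Env.induction with
      | elem n a =>
        rw [mulLeft_elem, Module.End.mul_apply, mulLeft_mulA, mulLeft_mulSeq, mul_assoc]
      | smul c x hx => rw [map_smul, LinearMap.smul_apply, map_smul, hx, smul_mul_assoc]
      | add x x' hx hx' => rw [map_add, LinearMap.add_apply, map_add, hx, hx', add_mul])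

theorem mul_def (x y : Env K A) : x * y = mulLeft K A x y := rfl

instance : Algebra K (Env K A) :=
  Algebra.ofModule
    (fun c x y => by rw [mul_def, map_smul]; rfl)
    (fun c x y => by rw [mul_def, map_smul]; rfl)

/-- The sequence `a₀, …, aᵢ₋₁, aᵢaᵢ₊₁, aᵢ₊₂, …`. -/
def contract (i : ℕ) (a : ℕ → A) (j : ℕ) : A :=
  if j < i then a j else if j = i then a i * a (i + 1) else a (j + 1)

theorem mulSeq_elem (n k : ℕ) (a : ℕ → A) :
    mulSeq K n a (elem K k fun j => a (n + j)) = ∑ i ∈ Finset.range (n + 1),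
      (-1 : ℤ) ^ (n - i) • elem K (n + k) (contract i (consSeq 1 a)) := by
  induction n generalizing a with
  | zero =>
    simp only [mulSeq, Module.End.one_apply, zero_add, Finset.sum_range_one, Nat.sub_self, pow_zero,
      one_smul]
    refine elem_congr fun i _ => ?_
    cases i <;> simp [contract, consSeq]
  | succ n ih =>
    have h := ih fun i => a (i + 1)
    rw [mulSeq, Module.End.mul_apply, show (fun j => a (n + 1 + j)) = fun j => a (n + j + 1) from
      funext fun j => by rw [Nat.add_right_comm], h, map_sum, Finset.sum_range_succ']
    rw [Finset.sum_range_succ' _ (n + 1), Finset.sum_range_succ' _ n, add_assoc]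
    simp only [map_zsmul, mulD_elem, show n + 1 + k = n + k + 1 by omega]
    refine congrArg₂ (· + ·) (Finset.sum_congr rfl fun i hi => ?_) ?_
    · rw [elem_eq_zero (a := consSeq (a 0) _) (0 : Fin (n + k + 1)) (by simp [contract, consSeq]),
        sub_zero, show n + 1 - (i + 1 + 1) = n - (i + 1) by omega]
      congr 2
      funext j
      rcases j with _ | _ | j <;> simp [contract, consSeq]
    · rw [smul_sub, sub_eq_add_neg, show n + 1 - (0 + 1) = n - 0 by omega,
        show n + 1 - 0 = n - 0 + 1 by omega, pow_succ, mul_neg_one, neg_smul]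
      congr 4
      · funext j
        rcases j with _ | _ | j <;> simp [contract, consSeq]
      · funext j
        rcases j with _ | _ | j <;> simp [contract, consSeq]

/-- The multiplication of `D(A)` on the spanning elements:
`(a₀ ⊗ ā₁ ⊗ ⋯ ⊗ āₙ)(aₙ₊₁ ⊗ āₙ₊₂ ⊗ ⋯ ⊗ āₘ) = (-1)ⁿ a₀a₁ ⊗ ā₂ ⊗ ⋯ ⊗ āₘ
+ ∑ᵢ₌₁ⁿ (-1)ⁿ⁻ⁱ a₀ ⊗ ā₁ ⊗ ⋯ ⊗ \overline{aᵢaᵢ₊₁} ⊗ ⋯ ⊗ āₘ`, where `m = n + k + 1`. -/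
theorem elem_mul_elem (n k : ℕ) (a : ℕ → A) :
    elem K n a * elem K k (fun j => a (n + 1 + j)) = ∑ i ∈ Finset.range (n + 1),
      (-1 : ℤ) ^ (n - i) • elem K (n + k) (contract i a) := by
  rw [mul_def, mulLeft_elem, Module.End.mul_apply,
    show (fun j => a (n + 1 + j)) = fun j => a (n + j + 1) from
      funext fun j => by rw [Nat.add_right_comm], mulSeq_elem n k fun i => a (i + 1), map_sum]
  refine Finset.sum_congr rfl fun i _ => ?_
  rw [map_zsmul, mulA_elem]
  congr 2
  funext j
  rcases i with _ | i <;> rcases j with _ | j <;> simp [contract, consSeq]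

variable (K A) in
/-- The homogeneous component `D(A)ₙ` as a subspace of `D(A)`. -/
def grade (n : ℕ) : Submodule K (Env K A) := summand K (EnvDeg K A) n

theorem elem_mem_grade (n : ℕ) (a : ℕ → A) : elem K n a ∈ grade K A n := ⟨_, rfl⟩

theorem grade_le_span (n : ℕ) :
    grade K A n ≤ Submodule.span K (Set.range (elem (A := A) K n)) := by
  rintro _ ⟨t, rfl⟩
  exact of_mem_span n t

theorem elem_mul_elem_mem (i j : ℕ) (a b : ℕ → A) :
    elem K i a * elem K j b ∈ grade K A (i + j) := by
  have h := elem_mul_elem (K := K) i j fun l => if l ≤ i then a l else b (l - (i + 1))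
  rw [elem_congr (n := i) (b := a) (fun l hl => if_pos hl),
    elem_congr (n := j) (b := b) (fun l _ => by
      rw [if_neg (by omega), Nat.add_sub_cancel_left])] at h
  rw [h]
  exact sum_mem fun l _ => zsmul_mem (elem_mem_grade _ _) _

instance : GradedAlgebra (grade K A) where
  one_mem := ⟨_, rfl⟩
  mul_mem := by
    intro i j x y hx hy
    have hle := mul_le_mul' (grade_le_span (K := K) (A := A) i) (grade_le_span j)
    rw [Submodule.span_mul_span] at hle
    refine Submodule.span_le.2 ?_ (hle (Submodule.mul_mem_mul hx hy))
    rintro _ ⟨_, ⟨a, rfl⟩, _, ⟨b, rfl⟩, rfl⟩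
    exact elem_mul_elem_mem i j a b
  toDecomposition := summandDecomposition K (EnvDeg K A)

end Env

end Envelope

end AssocGeom
end

/-!
The isomorphism comes from two maps in opposite directions.

The algebra homomorphism `OmegaAlg.toEnv : Ω•(A) → D(A)` is given by the universal property of the
tensor algebra of a bimodule (`TAlg.liftAlgHom`), applied to the inclusion `A → D(A)` and to
`Ω¹(A) → D(A)`, `a.db ↦ a ⊗ b̄`. The latter is the restriction of `A ⊗ A → D(A)`, `a ⊗ b ↦ a db`,
which is left linear, and which is right linear on the kernel of the multiplication: by the Leibniz
rule `a d(bc) = (a db) c + ab dc`, and the last term vanishes after summation since `∑ ab = 0`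
(`Env.ofTensor_rightMul`).

The linear map `OmegaAlg.ofEnv : D(A) → Ω•(A)` is `a₀ ⊗ ā₁ ⊗ ⋯ ⊗ āₙ ↦ a₀ da₁ ⋯ daₙ`, which is well
defined as `d1 = 0`. Since `a₀ ⊗ ā₁ ⊗ ⋯ ⊗ āₙ = a₀ da₁ ⋯ daₙ` holds in `D(A)` as well
(`Env.ofA_mul_prod_d`), `ofEnv` is a section of `toEnv`. It is surjective
(`OmegaAlg.ofEnv_surjective`): `Ω•(A)` is generated by `A` and the elements `db`, and the range of
`ofEnv` contains `1` and is stable under left multiplication by `a` and by `da`, because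
`da · b₀ db₁ ⋯ dbₙ = d(ab₀) db₁ ⋯ dbₙ - a db₀ db₁ ⋯ dbₙ`. Hence the two maps are inverse to each
other.

The differential of `Ω•(A)` inherits its properties from that of `D(A)`, where the graded Leibniz
rule (`Env.d_mul`) follows by moving `d` past the operators of left multiplication by
`a` and by `da`.
-/

namespace AssocGeom

/-! ### The universal property of the tensor algebra of a bimodule -/

section UniversalProperty

variable {K : Type u} {A : Type v} [CommRing K] [Ring A] [Algebra K A]
  {M : Type v} [AddCommGroup M] [Module K M] [Module A M] [Module Aᵐᵒᵖ M]
  [SMulCommClass A Aᵐᵒᵖ M] [IsScalarTower K A M] [IsScalarTower K Aᵐᵒᵖ M]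
  {B : Type w} [Ring B] [Algebra K B] {f : A →ₐ[K] B}

/-- A map that is semilinear over a homomorphism of `K`-algebras is `K`-linear. -/
def semilinearRestrict {P : Type*} [AddCommGroup P] [Module K P] [Module A P]
    [IsScalarTower K A P] (g : P →ₛₗ[(f : A →+* B)] B) : P →ₗ[K] B where
  toFun := g
  map_add' := map_add g
  map_smul' c p := by
    rw [← algebraMap_smul A c p, map_smulₛₗ]
    simp [Algebra.smul_def]

/-- The semilinear map `M ⊗_A N → B`, `m ⊗ n ↦ g m * h n`. -/
def BalTensor.mulLift {N : Type v} [AddCommGroup N] [Module K N] [Module A N]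
    [IsScalarTower K A N]
    (g : M →ₛₗ[(f : A →+* B)] B) (hg : ∀ a m, g (MulOpposite.op a • m) = g m * f a)
    (h : N →ₛₗ[(f : A →+* B)] B) : BalTensor K A M N →ₛₗ[(f : A →+* B)] B :=
  (balancedRel K A M N).liftQ
    { toFun := TensorProduct.lift ((LinearMap.mul K B).compl₁₂ (semilinearRestrict g)
        (semilinearRestrict h))
      map_add' := map_add _
      map_smul' := fun a x => by
        induction x with
        | zero => simp
        | tmul m n =>
          change g (a • m) * h n = f a * (g m * h n)
          rw [map_smulₛₗ, smul_eq_mul, mul_assoc]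
          rfl
        | add x y hx hy => rw [smul_add, map_add, map_add, hx, hy, smul_add] }
    (by
      refine Submodule.span_le.2 ?_
      rintro _ ⟨m, a, n, rfl⟩
      refine (map_sub _ _ _).trans (sub_eq_zero.2 ?_)
      change g (MulOpposite.op a • m) * h n = g m * h (a • n)
      rw [hg, map_smulₛₗ, smul_eq_mul, mul_assoc]
      rfl)

/-- The semilinear map `m₁ ⊗_A ⋯ ⊗_A mₙ ↦ g m₁ ⋯ g mₙ` on `T_Aⁿ(M)`, equal to `f` for `n = 0`. -/
def TPow.mulLift (g : M →ₛₗ[(f : A →+* B)] B)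
    (hg : ∀ a m, g (MulOpposite.op a • m) = g m * f a) :
    (n : ℕ) → TPow K A M n →ₛₗ[(f : A →+* B)] B
  | 0 =>
    { toFun := fun a => f ((TPow.zeroEquiv K A M).symm a)
      map_add' := fun a b => by simp
      map_smul' := fun a b => by simp }
  | 1 =>
    { toFun := fun m => g ((TPow.oneEquiv K A M).symm m)
      map_add' := fun a b => by simp
      map_smul' := fun a b => by simp }
  | n + 2 => BalTensor.mulLift g hg (TPow.mulLift g hg (n + 1))

theorem TPow.mulLift_cons (g : M →ₛₗ[(f : A →+* B)] B)
    (hg : ∀ a m, g (MulOpposite.op a • m) = g m * f a) :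
    ∀ (n : ℕ) (m : M) (t : TPow K A M n),
      TPow.mulLift g hg (n + 1) (TPow.cons K n m t) = g m * TPow.mulLift g hg n t
  | 0, m, t => by
    obtain ⟨a, rfl⟩ := (TPow.zeroEquiv K A M).surjective t
    exact hg a m
  | _ + 1, _, _ => rfl

namespace TAlg

/-- The `K`-linear map underlying `TAlg.liftAlgHom`. -/
def liftLinear (g : M →ₛₗ[(f : A →+* B)] B)
    (hg : ∀ a m, g (MulOpposite.op a • m) = g m * f a) : TAlg K A M →ₗ[K] B :=
  lift fun n => semilinearRestrict (TPow.mulLift g hg n)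

theorem liftLinear_of (g : M →ₛₗ[(f : A →+* B)] B)
    (hg : ∀ a m, g (MulOpposite.op a • m) = g m * f a) (n : ℕ) (t : TPow K A M n) :
    liftLinear g hg (of K A M n t) = TPow.mulLift g hg n t :=
  lift_of _ _ _

theorem liftLinear_smul (g : M →ₛₗ[(f : A →+* B)] B)
    (hg : ∀ a m, g (MulOpposite.op a • m) = g m * f a) (a : A) (x : TAlg K A M) :
    liftLinear g hg (a • x) = f a * liftLinear g hg x := by
  induction x using TAlg.induction with
  | zero => simp
  | of n t =>
    rw [smul_of, liftLinear_of, liftLinear_of, map_smulₛₗ]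
    rfl
  | add x y hx hy => rw [smul_add, map_add, map_add, hx, hy, mul_add]

theorem liftLinear_ofM_mul (g : M →ₛₗ[(f : A →+* B)] B)
    (hg : ∀ a m, g (MulOpposite.op a • m) = g m * f a) (m : M) (x : TAlg K A M) :
    liftLinear g hg (ofM K m * x) = g m * liftLinear g hg x := by
  induction x using TAlg.induction with
  | zero => simp
  | of n t => rw [ofM_mul_of, liftLinear_of, liftLinear_of, TPow.mulLift_cons]
  | add x y hx hy => rw [mul_add, map_add, map_add, hx, hy, mul_add]

theorem liftLinear_of_mul (g : M →ₛₗ[(f : A →+* B)] B)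
    (hg : ∀ a m, g (MulOpposite.op a • m) = g m * f a) :
    ∀ (n : ℕ) (t : TPow K A M n) (x : TAlg K A M),
      liftLinear g hg (of K A M n t * x) = TPow.mulLift g hg n t * liftLinear g hg x
  | 0, t, x => by
    obtain ⟨a, rfl⟩ := (TPow.zeroEquiv K A M).surjective t
    rw [← ofA_apply, ofA_mul, liftLinear_smul]
    rfl
  | 1, t, x => by
    obtain ⟨m, rfl⟩ := (TPow.oneEquiv K A M).surjective t
    rw [← ofM_apply, liftLinear_ofM_mul]
    rfl
  | n + 2, t, x => by
    induction t using TPow.induction with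
    | zero => simp
    | cons m t =>
      rw [← ofM_mul_of, mul_assoc, liftLinear_ofM_mul, liftLinear_of_mul g hg (n + 1),
        TPow.mulLift_cons, mul_assoc]
    | add s t hs ht => rw [map_add, add_mul, map_add, hs, ht, map_add, add_mul]

/-- The universal property of `T_A(M)`: an algebra homomorphism `f : A → B` and a map `g : M → B`
of `A`-bimodules, where `A` acts on `B` through `f`, extend to a homomorphism `T_A(M) → B`. Left
linearity of `g` is expressed as semilinearity over `f`. -/
def liftAlgHom (g : M →ₛₗ[(f : A →+* B)] B)
    (hg : ∀ a m, g (MulOpposite.op a • m) = g m * f a) : TAlg K A M →ₐ[K] B :=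
  AlgHom.ofLinearMap (liftLinear g hg)
    ((liftLinear_of g hg 0 _).trans (map_one f))
    (fun x y => by
      induction x using TAlg.induction with
      | zero => simp
      | of n t => rw [liftLinear_of_mul, liftLinear_of]
      | add x x' hx hx' => rw [add_mul, map_add, hx, hx', map_add, add_mul])

theorem liftAlgHom_ofA (g : M →ₛₗ[(f : A →+* B)] B)
    (hg : ∀ a m, g (MulOpposite.op a • m) = g m * f a) (a : A) :
    liftAlgHom g hg (ofA K a) = f a :=
  liftLinear_of g hg 0 _

theorem liftAlgHom_ofM (g : M →ₛₗ[(f : A →+* B)] B)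
    (hg : ∀ a m, g (MulOpposite.op a • m) = g m * f a) (m : M) :
    liftAlgHom g hg (ofM K m) = g m :=
  liftLinear_of g hg 1 _

theorem ofA_mul_ofA (a b : A) : ofA K (M := M) a * ofA K b = ofA K (a * b) := by
  rw [ofA_mul, ofA_apply, smul_of, ← map_smul]
  rfl

theorem ofA_mul_ofM (a : A) (m : M) : ofA K a * ofM K m = ofM (A := A) K (a • m) := by
  rw [ofA_mul, ofM_apply, smul_of, ← map_smul]
  rfl

theorem ofM_mul_ofA (a : A) (m : M) : ofM K m * ofA K a = ofM (A := A) K (MulOpposite.op a • m) := by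
  rw [ofA_apply, ofM_mul_of]
  rfl

/-- `T_A(M)` is generated by `A` and `M`: a subspace containing `1` and stable under left
multiplication by `A` and by `M` is everything. -/
theorem mem_of_stable (S : Submodule K (TAlg K A M)) (one : ofA K 1 ∈ S)
    (hA : ∀ a, ∀ x ∈ S, ofA K a * x ∈ S) (hM : ∀ m, ∀ x ∈ S, ofM K m * x ∈ S)
    (x : TAlg K A M) : x ∈ S := by
  have h0 (a : A) : ofA K a ∈ S := by
    simpa [ofA_mul_ofA] using hA a _ one
  have key : ∀ (n : ℕ) (t : TPow K A M n), of K A M n t ∈ S := by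
    intro n
    induction n with
    | zero =>
      intro t
      obtain ⟨a, rfl⟩ := (TPow.zeroEquiv K A M).surjective t
      exact h0 a
    | succ n ih =>
      intro t
      cases n with
      | zero =>
        obtain ⟨m, rfl⟩ := (TPow.oneEquiv K A M).surjective t
        have h := hM m _ one
        rwa [ofM_mul_ofA, MulOpposite.op_one, one_smul] at h
      | succ n =>
        induction t using TPow.induction with
        | zero => simp
        | cons m t =>
          rw [← ofM_mul_of]
          exact hM m _ (ih t)
        | add s t hs ht => rw [map_add]; exact add_mem hs ht
  induction x using TAlg.induction with
  | zero => exact zero_mem S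
  | of n t => exact key n t
  | add x y hx hy => exact add_mem hx hy

end TAlg

end UniversalProperty

variable {K : Type u} {A : Type v} [CommRing K] [Ring A] [Algebra K A]

/-! ### Noncommutative Kähler differentials -/

namespace Omega1

theorem val_d (a : A) : val (d K a) = 1 ⊗ₜ[K] a - a ⊗ₜ[K] 1 := rfl

theorem val_smul_d (a b : A) : val (a • d K b) = a ⊗ₜ[K] b - (a * b) ⊗ₜ[K] 1 := by
  rw [val_smul, val_d, map_sub]
  simp [leftMul]

theorem d_one : d K (1 : A) = 0 := val_injective (by rw [val_d, sub_self, map_zero])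

theorem d_mul (a b : A) : d K (a * b) = a • d K b + MulOpposite.op b • d K a := by
  apply val_injective
  rw [map_add, val_smul_d, val_op_smul, val_d, val_d, map_sub]
  simp [rightMul]

/-- The map `A ⊗ A → Ω¹(A)`, `a ⊗ b ↦ a.db`, a retraction of the inclusion (`smulD_val`). -/
def smulD : A ⊗[K] A →ₗ[K] Omega1 K A :=
  TensorProduct.lift (LinearMap.mk₂ K (fun a b => a • d K b)
    (fun _ _ _ => add_smul _ _ _) (fun _ _ _ => smul_assoc _ _ _)
    (fun _ _ _ => by rw [map_add, smul_add])
    (fun c a b => val_injective (by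
      rw [LinearMap.map_smul val, val_smul, val_smul, map_smul, map_smul, map_smul])))

/-- The splitting `a ⊗ b = (a ⊗ b - ab ⊗ 1) + ab ⊗ 1` of `A ⊗ A` as `Ω¹(A) ⊕ A`. -/
theorem val_smulD (x : A ⊗[K] A) :
    val (smulD x) = x - LinearMap.mul' K A x ⊗ₜ[K] 1 := by
  induction x with
  | zero => simp
  | tmul a b => exact val_smul_d a b
  | add x y hx hy =>
    rw [map_add, map_add, hx, hy, map_add, TensorProduct.add_tmul]
    abel

theorem smulD_val (ω : Omega1 K A) : smulD (val ω) = ω :=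
  val_injective (by rw [val_smulD, mul'_val, TensorProduct.zero_tmul, sub_zero])

/-- `Ω¹(A)` is additively generated by the elements `a.db`. -/
theorem induction {p : Omega1 K A → Prop} (zero : p 0) (smul_d : ∀ a b : A, p (a • d K b))
    (add : ∀ x y, p x → p y → p (x + y)) (ω : Omega1 K A) : p ω := by
  rw [← smulD_val ω]
  induction val ω with
  | zero => simpa using zero
  | tmul a b => exact smul_d a b
  | add x y hx hy => rw [map_add]; exact add _ _ hx hy

end Omega1

/-! ### The envelope as a differential graded algebra -/

namespace Env

theorem d_mul_d : d K A * d K A = 0 :=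
  hom_ext fun n a => by
    rw [Module.End.mul_apply, d_elem, d_elem, LinearMap.zero_apply]
    exact elem_eq_zero (0 : Fin (n + 2)) rfl

theorem d_mem_grade {n : ℕ} {x : Env K A} (hx : x ∈ grade K A n) : d K A x ∈ grade K A (n + 1) := by
  have h : grade K A n ≤ (grade K A (n + 1)).comap (d K A) := by
    refine (grade_le_span n).trans (Submodule.span_le.2 ?_)
    rintro _ ⟨a, rfl⟩
    change d K A (elem K n a) ∈ grade K A (n + 1)
    rw [d_elem]
    exact elem_mem_grade _ _
  exact h hx

theorem d_mul_mulA (a : A) : d K A * mulA K a = mulD K A (bar K a) + mulA K a * d K A := by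
  rw [mulD_bar, sub_add_cancel]

theorem d_mul_mulD (a : A) :
    d K A * mulD K A (bar K a) = -(mulD K A (bar K a) * d K A) := by
  rw [mulD_bar, mul_sub, sub_mul, ← mul_assoc, d_mul_d, mul_assoc (mulA K a), d_mul_d]
  noncomm_ring

theorem d_mul_mulSeq (n : ℕ) (a : ℕ → A) :
    d K A * mulSeq K n a = (-1 : ℤ) ^ n • (mulSeq K n a * d K A) := by
  induction n generalizing a with
  | zero => simp [mulSeq]
  | succ n ih =>
    rw [mulSeq, ← mul_assoc, d_mul_mulD, neg_mul, mul_assoc, ih, mul_smul_comm, pow_succ,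
      mul_neg_one, neg_smul, mul_assoc]

/-- The graded Leibniz rule. As an identity of operators it says that the graded commutator of `d`
with left multiplication by `x` is left multiplication by `d x`; for `x = a₀ (1 ⊗ ā₁) ⋯ (1 ⊗ āₙ)` it
follows by moving `d` past the factors one by one. -/
theorem d_mul {n : ℕ} {x : Env K A} (hx : x ∈ grade K A n) (y : Env K A) :
    d K A (x * y) = d K A x * y + (-1 : ℤ) ^ n • (x * d K A y) := by
  have hspan := grade_le_span n hx
  clear hx
  induction hspan using Submodule.span_induction with
  | mem x h =>
    obtain ⟨a, rfl⟩ := h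
    have key : d K A * mulLeft K A (elem K n a)
        = mulLeft K A (d K A (elem K n a)) + (-1 : ℤ) ^ n • (mulLeft K A (elem K n a) * d K A) := by
      rw [d_elem, mulLeft_elem, mulLeft_elem, ← mul_assoc, d_mul_mulA, add_mul, mul_assoc (mulA K _),
        d_mul_mulSeq, mul_smul_comm, ← mul_assoc (mulA K _)]
      simp only [consSeq, mulA_one, one_mul, mulSeq]
    exact LinearMap.congr_fun key y
  | zero => simp
  | add x x' _ _ hx hx' =>
    rw [add_mul, map_add, hx, hx', map_add, add_mul, add_mul, smul_add]
    abel
  | smul c x _ hx =>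
    rw [smul_mul_assoc, map_smul, hx, map_smul, smul_add, smul_mul_assoc, smul_mul_assoc,
      smul_comm c]

/-! ### The bimodule map from the Kähler differentials to the envelope -/

theorem one_def : (1 : Env K A) = elem K 0 1 := rfl

variable (K A) in
/-- The inclusion of degree zero, `A → D(A)`. -/
def ofA : A →ₐ[K] Env K A :=
  AlgHom.ofLinearMap ((LinearMap.applyₗ (1 : Env K A)).comp (mulA K))
    (by simp [mulA_one])
    (fun a b => by
      change mulA K (a * b) 1 = mulLeft K A (mulA K a 1) (mulA K b 1)
      rw [mulLeft_mulA, mulA_mul, Module.End.mul_apply, Module.End.mul_apply, ← mul_def, one_mul])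

theorem ofA_apply (a : A) : ofA K A a = elem K 0 fun _ => a := by
  change mulA K a (elem K 0 1) = _
  rw [mulA_elem]
  exact elem_congr fun i hi => by rw [Nat.le_zero.1 hi]; exact mul_one a

theorem ofA_mul (a : A) (x : Env K A) : ofA K A a * x = mulA K a x := by
  change mulLeft K A (mulA K a 1) x = _
  rw [mulLeft_mulA, Module.End.mul_apply, ← mul_def, one_mul]

theorem d_ofA_mul (a : A) (x : Env K A) : d K A (ofA K A a) * x = mulD K A (bar K a) x := by
  rw [ofA_apply, d_elem, mul_def, mulLeft_elem]
  simp [consSeq, mulA_one, mulSeq]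

/-- The map `A ⊗ A → D(A)`, `a ⊗ b ↦ a db = a ⊗ b̄`. -/
def ofTensor : A ⊗[K] A →ₗ[K] Env K A :=
  TensorProduct.lift ((LinearMap.mul K (Env K A)).compl₁₂ (ofA K A).toLinearMap
    (d K A ∘ₗ (ofA K A).toLinearMap))

theorem ofTensor_tmul (a b : A) :
    ofTensor (a ⊗ₜ[K] b) = ofA K A a * d K A (ofA K A b) := rfl

theorem d_ofA_mul_ofA (a b : A) : d K A (ofA K A (a * b))
    = d K A (ofA K A a) * ofA K A b + ofA K A a * d K A (ofA K A b) := by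
  rw [map_mul, d_mul (n := 0) (by rw [ofA_apply]; exact elem_mem_grade _ _), pow_zero, one_smul]

theorem d_one : d K A (1 : Env K A) = 0 := by
  rw [one_def, d_elem]
  exact elem_eq_zero (0 : Fin 1) rfl

theorem ofTensor_leftMul (a : A) (x : A ⊗[K] A) :
    ofTensor (Omega1.leftMul K a x) = ofA K A a * ofTensor x := by
  induction x with
  | zero => simp
  | tmul b c =>
    change ofTensor ((a * b) ⊗ₜ[K] c) = _
    rw [ofTensor_tmul, ofTensor_tmul, map_mul, mul_assoc]
  | add x y hx hy => rw [map_add, map_add, hx, hy, map_add, mul_add]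

/-- `ofTensor` is right linear up to a defect that vanishes on the kernel of multiplication. -/
theorem ofTensor_rightMul (b : A) (x : A ⊗[K] A) :
    ofTensor (Omega1.rightMul K b x) = ofTensor x * ofA K A b
      + ofA K A (LinearMap.mul' K A x) * d K A (ofA K A b) := by
  induction x with
  | zero => simp
  | tmul a c =>
    change ofTensor (a ⊗ₜ[K] (c * b)) = _
    rw [ofTensor_tmul, ofTensor_tmul, d_ofA_mul_ofA, LinearMap.mul'_apply, map_mul]
    noncomm_ring
  | add x y hx hy =>
    rw [map_add, map_add, hx, hy, map_add, map_add, map_add]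
    noncomm_ring

variable (K A) in
/-- The bimodule map `Ω¹(A) → D(A)`, `a.db ↦ a ⊗ b̄`. -/
def ofOmega1 : Omega1 K A →ₛₗ[(ofA K A : A →+* Env K A)] Env K A where
  toFun ω := ofTensor (Omega1.val ω)
  map_add' ω η := by rw [map_add, map_add]
  map_smul' a ω := by
    rw [Omega1.val_smul, ofTensor_leftMul]
    rfl

theorem ofOmega1_op_smul (a : A) (ω : Omega1 K A) :
    ofOmega1 K A (MulOpposite.op a • ω) = ofOmega1 K A ω * ofA K A a := by
  change ofTensor (Omega1.val (MulOpposite.op a • ω)) = ofTensor (Omega1.val ω) * _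
  rw [Omega1.val_op_smul, ofTensor_rightMul, Omega1.mul'_val, map_zero, zero_mul, add_zero]

theorem ofOmega1_d (a : A) : ofOmega1 K A (Omega1.d K a) = d K A (ofA K A a) := by
  change ofTensor (Omega1.val (Omega1.d K a)) = _
  rw [Omega1.val_d, map_sub, ofTensor_tmul, ofTensor_tmul, map_one, one_mul, d_one, mul_zero,
    sub_zero]

/-- The element `a₀ ⊗ ā₁ ⊗ ⋯ ⊗ āₙ` is the product `a₀ da₁ ⋯ daₙ` in `D(A)`. -/
theorem ofA_mul_prod_d (n : ℕ) (a : ℕ → A) :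
    ofA K A (a 0) * (List.ofFn fun i : Fin n => d K A (ofA K A (a (i + 1)))).prod
      = elem K n a := by
  have h : ∀ (n : ℕ) (a : ℕ → A),
      (List.ofFn fun i : Fin n => d K A (ofA K A (a i))).prod = mulSeq K n a 1 := by
    intro n
    induction n with
    | zero => exact fun _ => rfl
    | succ n ih =>
      intro a
      rw [List.ofFn_succ, List.prod_cons, d_ofA_mul, mulSeq, Module.End.mul_apply,
        ← ih fun i => a (i + 1)]
      rfl
  rw [h n fun i => a (i + 1), ofA_mul, one_def, mulSeq_one, mulA_elem]
  refine elem_congr fun i _ => ?_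
  cases i <;> simp [consSeq]

end Env

/-! ### The isomorphism and its inverse -/

namespace OmegaAlg

open TAlg

variable (K A) in
/-- The homomorphism `Ω•(A) → D(A)` that is the identity on `A` and sends `a.db` to `a ⊗ b̄`. -/
def toEnv : OmegaAlg K A →ₐ[K] Env K A :=
  liftAlgHom (Env.ofOmega1 K A) Env.ofOmega1_op_smul

theorem toEnv_ofA (a : A) : toEnv K A (ofA K a) = Env.ofA K A a := liftAlgHom_ofA _ _ a

theorem toEnv_ofM_d (a : A) :
    toEnv K A (ofM K (Omega1.d K a)) = Env.d K A (Env.ofA K A a) :=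
  (liftAlgHom_ofM _ _ _).trans (Env.ofOmega1_d a)

variable (K A) in
/-- The map `Ā → Ω•(A)`, `ā ↦ da`. -/
def dBar : Bar K A →ₗ[K] OmegaAlg K A :=
  (LinearMap.range (Algebra.linearMap K A)).liftQ (ofM K ∘ₗ Omega1.d K) (by
    rintro _ ⟨c, rfl⟩
    simp [Algebra.algebraMap_eq_smul_one, Omega1.d_one])

variable (K A) in
/-- The linear map `D(A) → Ω•(A)`, `a₀ ⊗ ā₁ ⊗ ⋯ ⊗ āₙ ↦ a₀.da₁ ⊗_A ⋯ ⊗_A daₙ`. -/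
def ofEnv : Env K A →ₗ[K] OmegaAlg K A :=
  Env.lift fun n => TensorProduct.lift ((LinearMap.mul K (OmegaAlg K A)).compl₁₂ (ofA K)
    (PiTensorProduct.lift ((MultilinearMap.mkPiAlgebraFin K n (OmegaAlg K A)).compLinearMap
      fun _ => dBar K A)))

theorem ofEnv_elem (n : ℕ) (a : ℕ → A) : ofEnv K A (Env.elem K n a)
    = ofA K (a 0) * (List.ofFn fun i : Fin n => ofM K (Omega1.d K (a (i + 1)))).prod := by
  rw [ofEnv, Env.elem, Env.lift_of, TensorProduct.lift.tmul, LinearMap.compl₁₂_apply,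
    PiTensorProduct.lift.tprod, LinearMap.mul_apply']
  rfl

theorem toEnv_ofEnv (x : Env K A) : toEnv K A (ofEnv K A x) = x := by
  have h : (toEnv K A).toLinearMap ∘ₗ ofEnv K A = LinearMap.id := Env.hom_ext fun n a => by
    change toEnv K A (ofEnv K A (Env.elem K n a)) = Env.elem K n a
    rw [ofEnv_elem, map_mul, map_list_prod, List.map_ofFn, toEnv_ofA, ← Env.ofA_mul_prod_d n a]
    simp only [Function.comp_def, toEnv_ofM_d]
  exact LinearMap.congr_fun h x

theorem ofA_mul_ofEnv (a : A) (x : Env K A) :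
    ofA K a * ofEnv K A x = ofEnv K A (Env.mulA K a x) := by
  induction x using Env.induction with
  | elem n b =>
    rw [Env.mulA_elem, ofEnv_elem, ofEnv_elem, ← mul_assoc, ofA_mul_ofA]
    rfl
  | smul c x hx => rw [map_smul, map_smul, map_smul, mul_smul_comm, hx]
  | add x y hx hy => rw [map_add, map_add, map_add, mul_add, hx, hy]

/-- The step `da · (b₀ db₁ ⋯ dbₙ) = d(ab₀) db₁ ⋯ dbₙ - a db₀ db₁ ⋯ dbₙ`. -/
theorem d_mul_ofEnv (a : A) (x : Env K A) :
    ofM K (Omega1.d K a) * ofEnv K A x = ofEnv K A (Env.mulD K A (bar K a) x) := by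
  induction x using Env.induction with
  | elem n b =>
    rw [Env.mulD_elem, map_sub, ofEnv_elem, ofEnv_elem, ofEnv_elem, ← mul_assoc, ofM_mul_ofA,
      List.ofFn_succ, List.ofFn_succ, List.prod_cons, List.prod_cons, ← mul_assoc, ← mul_assoc,
      ofA_mul_ofM, ofA_mul_ofM, eq_sub_of_add_eq' (Omega1.d_mul a (b 0)).symm, map_sub, sub_mul]
    simp [Env.consSeq]
  | smul c x hx => rw [map_smul, map_smul, map_smul, mul_smul_comm, hx]
  | add x y hx hy => rw [map_add, map_add, map_add, mul_add, hx, hy]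

/-- The range of `ofEnv` is stable under left multiplication by `A` and by `dA`, and `A` and `dA`
generate the tensor algebra. -/
theorem ofEnv_surjective : Function.Surjective (ofEnv K A) := by
  refine fun x => mem_of_stable (LinearMap.range (ofEnv K A)) ⟨1, ?_⟩ ?_ ?_ x
  · simpa [Env.one_def] using ofEnv_elem (K := K) 0 (1 : ℕ → A)
  · rintro a _ ⟨y, rfl⟩
    exact ⟨_, (ofA_mul_ofEnv a y).symm⟩
  · rintro ω _ ⟨y, rfl⟩
    induction ω using Omega1.induction with
    | zero => simp
    | smul_d a b =>
      rw [← ofA_mul_ofM, mul_assoc, d_mul_ofEnv, ofA_mul_ofEnv]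
      exact ⟨_, rfl⟩
    | add ω η hω hη => rw [map_add, add_mul]; exact add_mem hω hη

variable (K A) in
/-- The isomorphism `Ω•(A) ≃ D(A)`. -/
def equivEnv : OmegaAlg K A ≃ₐ[K] Env K A :=
  { toEnv K A with
    invFun := ofEnv K A
    left_inv := fun x => by
      obtain ⟨y, rfl⟩ := ofEnv_surjective x
      exact congrArg (ofEnv K A) (toEnv_ofEnv y)
    right_inv := toEnv_ofEnv }

theorem equivEnv_apply (x : OmegaAlg K A) : equivEnv K A x = toEnv K A x := rfl

theorem ofA_mem_grade (a : A) : ofA K a ∈ grade K A (Omega1 K A) 0 := ⟨_, rfl⟩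

theorem ofM_mem_grade (ω : Omega1 K A) : ofM K ω ∈ grade K A (Omega1 K A) 1 := ⟨_, rfl⟩

theorem ofEnv_mem_grade {n : ℕ} {x : Env K A} (hx : x ∈ Env.grade K A n) :
    ofEnv K A x ∈ grade K A (Omega1 K A) n := by
  have hprod : ∀ (n : ℕ) (ω : Fin n → Omega1 K A),
      (List.ofFn fun i => ofM K (ω i)).prod ∈ grade K A (Omega1 K A) n := by
    intro n
    induction n with
    | zero => exact fun _ => ofA_mem_grade 1
    | succ n ih =>
      intro ω
      rw [List.ofFn_succ, List.prod_cons]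
      have h := SetLike.mul_mem_graded (ofM_mem_grade (ω 0)) (ih fun i => ω i.succ)
      rwa [Nat.add_comm 1 n] at h
  have h : Env.grade K A n ≤ (grade K A (Omega1 K A) n).comap (ofEnv K A) := by
    refine (Env.grade_le_span n).trans (Submodule.span_le.2 ?_)
    rintro _ ⟨a, rfl⟩
    change ofEnv K A (Env.elem K n a) ∈ grade K A (Omega1 K A) n
    rw [ofEnv_elem]
    simpa using SetLike.mul_mem_graded (ofA_mem_grade (a 0)) (hprod n _)
  exact h hx

theorem ofOmega1_mem_grade (ω : Omega1 K A) : Env.ofOmega1 K A ω ∈ Env.grade K A 1 := by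
  induction ω using Omega1.induction with
  | zero => simp
  | smul_d a b =>
    rw [map_smulₛₗ, Env.ofOmega1_d, smul_eq_mul, ← Nat.zero_add 1]
    change Env.ofA K A a * _ ∈ _
    rw [Env.ofA_apply, Env.ofA_apply]
    exact SetLike.mul_mem_graded (Env.elem_mem_grade _ _) (Env.d_mem_grade (Env.elem_mem_grade _ _))
  | add x y hx hy => rw [map_add]; exact add_mem hx hy

theorem toEnv_of_mem_grade (n : ℕ) (t : TPow K A (Omega1 K A) n) :
    toEnv K A (of K A (Omega1 K A) n t) ∈ Env.grade K A n := by
  induction n with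
  | zero =>
    obtain ⟨a, rfl⟩ := (TPow.zeroEquiv K A _).surjective t
    rw [← TAlg.ofA_apply, toEnv_ofA, Env.ofA_apply]
    exact Env.elem_mem_grade _ _
  | succ n ih =>
    cases n with
    | zero =>
      obtain ⟨ω, rfl⟩ := (TPow.oneEquiv K A _).surjective t
      rw [← ofM_apply, toEnv, liftAlgHom_ofM]
      exact ofOmega1_mem_grade ω
    | succ n =>
      induction t using TPow.induction with
      | zero => simp
      | cons ω t =>
        rw [← ofM_mul_of, map_mul, Nat.add_comm]
        refine SetLike.mul_mem_graded ?_ (ih t)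
        rw [toEnv, liftAlgHom_ofM]
        exact ofOmega1_mem_grade ω
      | add s t hs ht => rw [map_add, map_add]; exact add_mem hs ht

theorem toEnv_mem_grade {n : ℕ} {x : OmegaAlg K A} (hx : x ∈ grade K A (Omega1 K A) n) :
    toEnv K A x ∈ Env.grade K A n := by
  obtain ⟨t, rfl⟩ := hx
  exact toEnv_of_mem_grade n t

end OmegaAlg

end AssocGeom

open AssocGeom in
theorem mainTheorem1 (K : Type u) (A : Type v) [Field K] [CharZero K] [Ring A] [Algebra K A] :
    ∃ Ψ : AssocGeom.OmegaAlg K A ≃ₐ[K] AssocGeom.Env K A,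
      -- `Ψ` is an isomorphism of graded algebras
      (∀ n : ℕ, (AssocGeom.TAlg.grade K A (AssocGeom.Omega1 K A) n).map Ψ.toLinearMap
        = AssocGeom.Env.grade K A n) ∧
      -- it is the identity of `A` in degree zero and `a.db ↦ a ⊗ b̄` in degree one
      (∀ a : A, Ψ (AssocGeom.TAlg.ofA K a) = AssocGeom.Env.elem K 0 fun _ => a) ∧
      (∀ a b : A, Ψ (AssocGeom.TAlg.ofM K (a • AssocGeom.Omega1.d K b))
        = AssocGeom.Env.of K A 1
            (a ⊗ₜ[K] PiTensorProduct.tprod K fun _ : Fin 1 => AssocGeom.bar K b)) ∧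
      -- its inverse sends `a₀ ⊗ ā₁ ⊗ ⋯ ⊗ āₙ` to `a₀.da₁ ⊗_A da₂ ⊗_A ⋯ ⊗_A daₙ`
      (∀ (n : ℕ) (a : ℕ → A), Ψ.symm (AssocGeom.Env.elem K n a)
        = AssocGeom.TAlg.ofA K (a 0) * (List.ofFn fun i : Fin n =>
            AssocGeom.TAlg.ofM K (AssocGeom.Omega1.d K (a (i + 1)))).prod) ∧
      -- the differential of `D(A)`, carried over by `Ψ`, makes `Ω•(A)` a dg-algebra
      ∃ δ : AssocGeom.OmegaAlg K A →ₗ[K] AssocGeom.OmegaAlg K A,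
        (∀ x, δ x = Ψ.symm (AssocGeom.Env.d K A (Ψ x))) ∧
        (∀ a : A, δ (AssocGeom.TAlg.ofA K a)
          = AssocGeom.TAlg.ofM K (AssocGeom.Omega1.d K a)) ∧
        (∀ (n : ℕ), ∀ x ∈ AssocGeom.TAlg.grade K A (AssocGeom.Omega1 K A) n,
          δ x ∈ AssocGeom.TAlg.grade K A (AssocGeom.Omega1 K A) (n + 1)) ∧
        (∀ x, δ (δ x) = 0) ∧
        (∀ (n : ℕ), ∀ x ∈ AssocGeom.TAlg.grade K A (AssocGeom.Omega1 K A) n, ∀ y,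
          δ (x * y) = δ x * y + (-1 : ℤ) ^ n • (x * δ y)) := by
  refine ⟨OmegaAlg.equivEnv K A, fun n => le_antisymm ?_ fun x hx => ?_, fun a => ?_, fun a b => ?_,
    OmegaAlg.ofEnv_elem, OmegaAlg.ofEnv K A ∘ₗ Env.d K A ∘ₗ (OmegaAlg.toEnv K A).toLinearMap,
    fun x => rfl, fun a => ?_, fun n x hx => ?_, fun x => ?_, fun n x hx y => ?_⟩
  · rintro _ ⟨x, hx, rfl⟩
    exact OmegaAlg.toEnv_mem_grade hx
  · exact ⟨_, OmegaAlg.ofEnv_mem_grade hx, OmegaAlg.toEnv_ofEnv x⟩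
  · rw [OmegaAlg.equivEnv_apply, OmegaAlg.toEnv_ofA, Env.ofA_apply]
  · rw [OmegaAlg.equivEnv_apply, ← TAlg.ofA_mul_ofM, map_mul, OmegaAlg.toEnv_ofA,
      OmegaAlg.toEnv_ofM_d]
    simpa [Env.elem] using Env.ofA_mul_prod_d (K := K) 1 fun i => if i = 0 then a else b
  · change OmegaAlg.ofEnv K A (Env.d K A (OmegaAlg.toEnv K A (TAlg.ofA K a))) = _
    rw [OmegaAlg.toEnv_ofA, ← OmegaAlg.toEnv_ofM_d]
    exact (OmegaAlg.equivEnv K A).symm_apply_apply (TAlg.ofM K (Omega1.d K a))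
  · exact OmegaAlg.ofEnv_mem_grade (Env.d_mem_grade (OmegaAlg.toEnv_mem_grade hx))
  · change OmegaAlg.ofEnv K A (Env.d K A (OmegaAlg.toEnv K A (OmegaAlg.ofEnv K A
      (Env.d K A (OmegaAlg.toEnv K A x))))) = 0
    rw [OmegaAlg.toEnv_ofEnv, ← Module.End.mul_apply, Env.d_mul_d, LinearMap.zero_apply, map_zero]
  · change (OmegaAlg.equivEnv K A).symm (Env.d K A (OmegaAlg.toEnv K A (x * y))) = 
      (OmegaAlg.equivEnv K A).symm (Env.d K A (OmegaAlg.toEnv K A x)) * y + (-1 : ℤ) ^ n •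
      (x * (OmegaAlg.equivEnv K A).symm (Env.d K A (OmegaAlg.toEnv K A y)))
    apply (OmegaAlg.equivEnv K A).injective
    simp only [map_mul, map_add, map_zsmul, AlgEquiv.apply_symm_apply]
    exact Env.d_mul (OmegaAlg.toEnv_mem_grade hx) _
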